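/- Let $\mathbb F_q$ be a finite field with $q$ elements and let $n$ be a positive integer with $\gcd(n,q)=1$. For $\lambda\in\mathbb F_q^*$, a $\lambda$-constacyclic code of length $n$ over $\mathbb F_q$ is a linear code $\mathcal C\subseteq\mathbb F_q^n$ which, under $(u_0,\dots,u_{n-1})\mapsto u_0+u_1x+\cdots+u_{n-1}x^{n-1}$, is an ideal of $\mathbb F_q[x]/\langle x^n-\lambda\rangle$; it is called cyclic if $\lambda=1$ and negacyclic if $\lambda=-1$. The code $\mathcal C$ is Euclidean LCD if $\mathcal C\cap\mathcal C^{\perp}=\{0\}$, where $\mathcal C^{\perp}=\{u\in\mathbb F_q^n:\sum_i u_iv_i=0\text{ for all }v\in\mathcal C\}$. A monic polynomial $f\in\mathbb F_q[x]$ with $f(0)\ne 0$ is self-reciprocal if $f(x)=f(0)^{-1}x^{\deg f}f(1/x)$. For $\lambda\in\mathbb F_q^*$ let $N_1=N_1(\lambda)$ be the number of monic irreducible factors of $x^n-\lambda$ over $\mathbb F_q$, and let $N_2=N_2(\lambda)$ be the number of those that are self-reciprocal. (1) If $\lambda\in\mathbb F_q^*$ and $\lambda\notin\{1,-1\}$,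 then every $\lambda$-constacyclic code of length $n$ over $\mathbb F_q$ is Euclidean LCD. (2) For $\lambda=1$, $N_1+N_2$ is even and there are exactly $2^{(N_1+N_2)/2}$ Euclidean LCD cyclic codes of length $n$ over $\mathbb F_q$. (3) For $\lambda=-1$, $N_1+N_2$ is even and there are exactly $2^{(N_1+N_2)/2}$ Euclidean LCD negacyclic codes of length $n$ over $\mathbb F_q$. In (2) and (3) the numbers $N_1$ and $N_2$ are given explicitly as follows. Let $r$ be the multiplicative order of $\lambda$, and write $n=n_1n_2$ with $\operatorname{rad}(n_1)\mid\operatorname{rad}(r)$ and $\gcd(n_2,r)=1$, where $\operatorname{rad}(m)$ is the product of the distinct primes dividing $m$. Then $$N_1=n_1\sum_{d\mid n_2}\frac{\phi(d)}{\operatorname{ord}_{rdn_1}(q)},\qquad N_2=n_1\sum_{d\in S(n,r)}\frac{\phi(d)}{\operatorname{ord}_{rdn_1}(q)},$$ where $\phi$ is Euler's function, $\operatorname{ord}_m(q)$ is the multiplicative order of $q$ modulo $m$, and $S(n,r)$ is the set of divisors $d$ of $n_2$ for which there is a positive integer $w$ with $q^w\equiv-1\pmod{rdn_1}$. -/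

import Mathlib

open Polynomial

noncomputable section

namespace LCDCodes

/-- The polynomial `u₀ + u₁ x + ⋯ + u_{n-1} x^{n-1}` attached to a vector `u ∈ Fⁿ`. -/
def vecPoly {F : Type*} [Field F] {n : ℕ} (u : Fin n → F) : F[X] :=
  ∑ i : Fin n, Polynomial.C (u i) * X ^ (i : ℕ)

/-- A linear code `D ⊆ Fⁿ` is `lam`-constacyclic if, under the identification
`u ↦ u₀ + u₁ x + ⋯ + u_{n-1} x^{n-1}`, it is an ideal of `F[x] / ⟨xⁿ - lam⟩`. -/
def IsConstacyclic {F : Type*} [Field F] {n : ℕ} (lam : F)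
    (D : Submodule F (Fin n → F)) : Prop :=
  ∃ I : Ideal (F[X] ⧸ Ideal.span {(X ^ n - Polynomial.C lam : F[X])}),
    ∀ u : Fin n → F,
      u ∈ D ↔ Ideal.Quotient.mk (Ideal.span {(X ^ n - Polynomial.C lam : F[X])}) (vecPoly u) ∈ I

/-- The Euclidean dual code: all `u` with `∑ uᵢ vᵢ = 0` for every `v ∈ D`. -/
def euclideanDual {F : Type*} [Field F] {n : ℕ} (D : Submodule F (Fin n → F)) :
    Submodule F (Fin n → F) where
  carrier := {u | ∀ v ∈ D, ∑ i, u i * v i = 0}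
  zero_mem' := by
    intro v _
    simp
  add_mem' := by
    intro a b ha hb v hv
    have h1 : ∑ i, a i * v i = 0 := ha v hv
    have h2 : ∑ i, b i * v i = 0 := hb v hv
    simp [add_mul, Finset.sum_add_distrib, h1, h2]
  smul_mem' := by
    intro c a ha v hv
    have h1 : ∑ i, a i * v i = 0 := ha v hv
    simp [mul_assoc, ← Finset.mul_sum, h1]

/-- Euclidean linear complementary dual: `D ∩ D^⊥ = {0}`. -/
def IsEuclideanLCD {F : Type*} [Field F] {n : ℕ} (D : Submodule F (Fin n → F)) : Prop :=
  D ⊓ euclideanDual D = ⊥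

/-- The normalised reciprocal polynomial `f* = f(0)⁻¹ x^{deg f} f(1/x)`; it is meant for `f(0) ≠ 0`
(`Polynomial.reverse f` is `x^{deg f} f(1/x)`). -/
def reciprocal {F : Type*} [Field F] (f : F[X]) : F[X] :=
  Polynomial.C (f.coeff 0)⁻¹ * f.reverse

/-- A monic polynomial with nonzero constant term is self-reciprocal if `f = f*`. -/
def IsSelfReciprocal {F : Type*} [Field F] (f : F[X]) : Prop :=
  f.Monic ∧ f.coeff 0 ≠ 0 ∧ f = reciprocal f

/-- The monic irreducible factors of `xⁿ - lam` over `F`. -/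
def irredFactors {F : Type*} [Field F] (n : ℕ) (lam : F) : Set F[X] :=
  {f | f.Monic ∧ Irreducible f ∧ f ∣ X ^ n - Polynomial.C lam}

/-- `N₁`, the number of irreducible factors of `xⁿ - lam` over `F`. -/
def N₁ {F : Type*} [Field F] (n : ℕ) (lam : F) : ℕ :=
  (irredFactors n lam).ncard

/-- `N₂`, the number of self-reciprocal irreducible factors of `xⁿ - lam` over `F`. -/
def N₂ {F : Type*} [Field F] (n : ℕ) (lam : F) : ℕ :=
  {f | f ∈ irredFactors n lam ∧ IsSelfReciprocal f}.ncard

/-- The multiplicative order of `q` modulo `m` (used for `gcd(q, m) = 1`). -/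
def ordMod (m q : ℕ) : ℕ := orderOf (q : ZMod m)

/-- `n₁ ∑_{d ∣ n₂} φ(d) / ord_{r d n₁}(q)`. -/
def formulaN₁ (q r n₁ n₂ : ℕ) : ℚ :=
  n₁ * ∑ d ∈ n₂.divisors, (d.totient : ℚ) / (ordMod (r * d * n₁) q : ℚ)

open Classical in
/-- `n₁ ∑ φ(d) / ord_{r d n₁}(q)`, over the divisors `d` of `n₂` for which there is a positive
integer `w` with `q ^ w ≡ -1 (mod r d n₁)`. -/
def formulaN₂ (q r n₁ n₂ : ℕ) : ℚ :=
  n₁ * ∑ d ∈ n₂.divisors with ∃ w : ℕ, 0 < w ∧ (q : ℤ) ^ w ≡ -1 [ZMOD ((r * d * n₁ : ℕ) : ℤ)],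
    (d.totient : ℚ) / (ordMod (r * d * n₁) q : ℚ)

end LCDCodes

end

/-!
Write `xⁿ - λ = g h`. Constacyclic codes are the codes `generatedCode n g` of multiples of a monic
divisor `g`, and the dual of such a code consists of the multiples of the reciprocal polynomial
`h*` (`euclideanDual_generatedCode`): the Euclidean product of two vectors is the coefficient of
`x^{n-1}` in the product of one polynomial and the reversal of the other, and this coefficient
vanishes on the multiples of `xⁿ - λ` of degree at most `2n - 2`. Since `deg g + deg h* = n`, the
code meets its dual trivially if and only if `g` and `h*` are coprime
(`isEuclideanLCD_generatedCode_iff_isCoprime`).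

If `λ ≠ ±1`, then `g` divides `xⁿ - λ` and `h*` divides `xⁿ - λ⁻¹`, and these are coprime. If
`λ = ±1`, then `g h = g* h*` is squarefree and coprimality of `g` and `h*` means `g = g*`. Such `g`
correspond to the sets of monic irreducible factors of `xⁿ - λ` that are closed under the involution
`f ↦ f*`, hence to the sets of orbits of this involution, and `N₁ + N₂` is twice the number of
orbits (`N₁_add_N₂_eq`).

For the explicit values, `xⁿ - λ` is the product of the cyclotomic polynomials `Φ_{r d n₁}` with
`d ∣ n₂` (`prod_cyclotomic_eq`). Each irreducible factor of `Φ_m` has degree `ord_m(q)`, and as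
its roots are the conjugates `α^{q^w}` of a primitive `m`-th root of unity `α`, it is
self-reciprocal if and only if some power of `q` is `-1` modulo `m`
(`isSelfReciprocal_iff_exists_pow`).
-/

namespace LCDCodes

/-! ### Reciprocal polynomials -/

section Reciprocal

variable {F : Type*} [Field F]

theorem natDegree_reverse_of_coeff_zero_ne {f : F[X]} (h : f.coeff 0 ≠ 0) :
    f.reverse.natDegree = f.natDegree := by
  rw [reverse_natDegree, natTrailingDegree_eq_zero.mpr (Or.inr h), Nat.sub_zero]

theorem reverse_reverse_of_coeff_zero_ne {f : F[X]} (h : f.coeff 0 ≠ 0) :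
    f.reverse.reverse = f := by
  conv_lhs => rw [reverse, natDegree_reverse_of_coeff_zero_ne h, reverse, reflect_reflect]

theorem natDegree_reciprocal {f : F[X]} (h : f.coeff 0 ≠ 0) :
    (reciprocal f).natDegree = f.natDegree := by
  rw [reciprocal, natDegree_C_mul (inv_ne_zero h), natDegree_reverse_of_coeff_zero_ne h]

theorem reciprocal_monic {f : F[X]} (h : f.coeff 0 ≠ 0) : (reciprocal f).Monic := by
  rw [reciprocal, Monic, leadingCoeff_mul, leadingCoeff_C, reverse_leadingCoeff,
    trailingCoeff_eq_coeff_zero h, inv_mul_cancel₀ h]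

theorem coeff_zero_reciprocal (f : F[X]) :
    (reciprocal f).coeff 0 = (f.coeff 0)⁻¹ * f.leadingCoeff := by
  rw [reciprocal, coeff_C_mul, coeff_zero_reverse]

theorem coeff_zero_reciprocal_ne {f : F[X]} (h : f.coeff 0 ≠ 0) :
    (reciprocal f).coeff 0 ≠ 0 := by
  have hf : f ≠ 0 := by rintro rfl; simp at h
  rw [coeff_zero_reciprocal]
  exact mul_ne_zero (inv_ne_zero h) (leadingCoeff_ne_zero.mpr hf)

theorem reciprocal_mul (f g : F[X]) : reciprocal (f * g) = reciprocal f * reciprocal g := by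
  simp only [reciprocal, reverse_mul_of_domain, mul_coeff_zero, mul_inv, C_mul]
  ring

theorem reciprocal_one : reciprocal (1 : F[X]) = 1 := by
  have : (1 : F[X]).reverse = 1 := reverse_C 1
  simp [reciprocal, this]

theorem reciprocal_dvd_reciprocal {f g : F[X]} (h : f ∣ g) : reciprocal f ∣ reciprocal g := by
  obtain ⟨k, rfl⟩ := h
  exact ⟨_, reciprocal_mul f k⟩

theorem reverse_C_mul (c : F) (f : F[X]) : (C c * f).reverse = C c * f.reverse := by
  rw [reverse_mul_of_domain, reverse_C]

theorem reciprocal_reciprocal {f : F[X]} (hm : f.Monic) (h : f.coeff 0 ≠ 0) :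
    reciprocal (reciprocal f) = f := by
  rw [reciprocal, coeff_zero_reciprocal, hm.leadingCoeff, mul_one, inv_inv, reciprocal,
    reverse_C_mul, reverse_reverse_of_coeff_zero_ne h, ← mul_assoc, ← C_mul, mul_inv_cancel₀ h,
    C_1, one_mul]

theorem irreducible_reciprocal {f : F[X]} (hf : Irreducible f) (hm : f.Monic)
    (h : f.coeff 0 ≠ 0) : Irreducible (reciprocal f) := by
  refine (reciprocal_monic h).irreducible_iff_natDegree.mpr ⟨fun h1 => ?_, fun a b ha hb hab => ?_⟩
  · apply hm.irreducible_iff_natDegree.mp hf |>.1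
    rw [← reciprocal_reciprocal hm h, h1, reciprocal_one]
  · have h0 : a.coeff 0 * b.coeff 0 ≠ 0 := by
      rw [← mul_coeff_zero, hab]
      exact coeff_zero_reciprocal_ne h
    have ha0 := left_ne_zero_of_mul h0
    have hb0 := right_ne_zero_of_mul h0
    have := (hm.irreducible_iff_natDegree.mp hf).2 _ _ (reciprocal_monic ha0) (reciprocal_monic hb0)
      (by rw [← reciprocal_mul, hab, reciprocal_reciprocal hm h])
    rwa [natDegree_reciprocal ha0, natDegree_reciprocal hb0] at this

theorem coeff_zero_X_pow_sub_C {n : ℕ} (hn : 0 < n) (lam : F) :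
    (X ^ n - C lam : F[X]).coeff 0 = -lam := by
  simp [coeff_X_pow, hn.ne]

theorem reciprocal_X_pow_sub_C {n : ℕ} (hn : 0 < n) {lam : F} (hl : lam ≠ 0) :
    reciprocal (X ^ n - C lam) = X ^ n - C lam⁻¹ := by
  have h1 : (X ^ n - C lam : F[X]).reverse = 1 - C lam * X ^ n := by
    rw [reverse, natDegree_X_pow_sub_C, reflect_sub, reflect_C, reflect_monomial, revAt_le le_rfl,
      Nat.sub_self, pow_zero]
  have h2 : (C lam⁻¹ * C lam : F[X]) = 1 := by rw [← C_mul, inv_mul_cancel₀ hl, C_1]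
  rw [reciprocal, h1, coeff_zero_X_pow_sub_C hn, inv_neg, C_neg]
  linear_combination (X ^ n) * h2

theorem coeff_zero_ne_of_dvd {f g : F[X]} (h : f ∣ g) (hg : g.coeff 0 ≠ 0) : f.coeff 0 ≠ 0 := by
  obtain ⟨k, rfl⟩ := h
  rw [mul_coeff_zero] at hg
  exact left_ne_zero_of_mul hg

/-- Divisibility by the reciprocal polynomial is divisibility of the reversed polynomial, whatever
length `N ≥ deg f` is used for the reversal: extra powers of `x` do not matter because
`h(0) ≠ 0`. -/
theorem reciprocal_dvd_iff_dvd_reflect {f h : F[X]} {N : ℕ} (hN : f.natDegree ≤ N)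
    (h0 : h.coeff 0 ≠ 0) : reciprocal h ∣ f ↔ h ∣ f.reflect N := by
  have hh : h ≠ 0 := by rintro rfl; simp at h0
  -- Reversal turns a divisor into the reversed divisor; used for `h` and for its reverse.
  have key : ∀ {a p : F[X]}, a.natDegree = a.reverse.natDegree → a ≠ 0 → p.natDegree ≤ N →
      a ∣ p → a.reverse ∣ p.reflect N := by
    rintro a p had ha hp ⟨k, rfl⟩
    rcases eq_or_ne k 0 with rfl | hk
    · simp
    · rw [natDegree_mul ha hk] at hp
      obtain ⟨m, rfl⟩ := Nat.exists_eq_add_of_le (show a.natDegree ≤ N by omega)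
      rw [reflect_mul a k le_rfl (by omega)]
      exact ⟨_, rfl⟩
  have hrev := natDegree_reverse_of_coeff_zero_ne h0
  have hu : IsUnit (C (h.coeff 0)⁻¹ : F[X]) := isUnit_C.mpr (inv_ne_zero h0).isUnit
  rw [reciprocal, hu.mul_left_dvd]
  constructor
  · intro hd
    have := key (by rw [reverse_reverse_of_coeff_zero_ne h0, hrev]) (by simpa using hh) hN hd
    rwa [reverse_reverse_of_coeff_zero_ne h0] at this
  · intro hd
    have := key hrev.symm hh (natDegree_reflect_le.trans (by omega)) hd
    rwa [reflect_reflect] at this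

end Reciprocal

/-! ### Constacyclic codes and their generator polynomials -/

section Codes

variable {F : Type*} [Field F] {n : ℕ}

theorem coeff_vecPoly (u : Fin n → F) (i : Fin n) : (vecPoly u).coeff i = u i := by
  rw [vecPoly, finsetSum_coeff, Finset.sum_eq_single i]
  · simp
  · intro b _ hb
    rw [coeff_C_mul_X_pow, if_neg]
    exact fun h => hb (Fin.ext h.symm)
  · simp

theorem degree_vecPoly_lt (u : Fin n → F) : (vecPoly u).degree < n := by
  refine (degree_sum_le _ _).trans_lt ((Finset.sup_lt_iff (WithBot.bot_lt_coe n)).mpr fun i _ => ?_)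
  exact (degree_C_mul_X_pow_le _ _).trans_lt (Nat.cast_lt.mpr i.2)

theorem natDegree_vecPoly_le (u : Fin n → F) : (vecPoly u).natDegree ≤ n - 1 := by
  rw [natDegree_le_iff_coeff_eq_zero]
  intro N hN
  exact coeff_eq_zero_of_degree_lt
    ((degree_vecPoly_lt u).trans_le (by exact_mod_cast (by omega : n ≤ N)))

theorem exists_vecPoly_eq {f : F[X]} (hf : f.degree < n) : ∃ u : Fin n → F, vecPoly u = f := by
  refine ⟨fun i => f.coeff i, ?_⟩
  ext k
  by_cases hk : k < n
  · exact coeff_vecPoly (fun i : Fin n => f.coeff i) ⟨k, hk⟩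
  · have hk' : (n : WithBot ℕ) ≤ k := by exact_mod_cast (not_lt.mp hk)
    rw [coeff_eq_zero_of_degree_lt (hf.trans_le hk'),
      coeff_eq_zero_of_degree_lt ((degree_vecPoly_lt _).trans_le hk')]

theorem vecPoly_eq_zero {u : Fin n → F} : vecPoly u = 0 ↔ u = 0 := by
  constructor
  · intro h
    ext i
    rw [← coeff_vecPoly u i, h]
    simp
  · rintro rfl
    simp [vecPoly]

theorem vecPoly_add (u v : Fin n → F) : vecPoly (u + v) = vecPoly u + vecPoly v := by
  simp [vecPoly, add_mul, Finset.sum_add_distrib]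

theorem vecPoly_smul (c : F) (u : Fin n → F) : vecPoly (c • u) = C c * vecPoly u := by
  simp [vecPoly, Finset.mul_sum, mul_assoc]

/-- The code of length `n` generated by `g`: the vectors whose polynomial is a multiple of `g`. -/
def generatedCode (n : ℕ) (g : F[X]) : Submodule F (Fin n → F) where
  carrier := {u | g ∣ vecPoly u}
  zero_mem' := by simp [vecPoly]
  add_mem' := fun ha hb => by
    simp only [Set.mem_ofPred_eq, vecPoly_add] at *
    exact dvd_add ha hb
  smul_mem' := fun c u hu => by
    simp only [Set.mem_ofPred_eq, vecPoly_smul] at *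
    exact hu.mul_left _

theorem mem_generatedCode {g : F[X]} {u : Fin n → F} : u ∈ generatedCode n g ↔ g ∣ vecPoly u :=
  Iff.rfl

theorem isConstacyclic_iff_exists_generator (hn : 0 < n) (lam : F)
    (D : Submodule F (Fin n → F)) :
    IsConstacyclic lam D ↔ ∃ g : F[X], g.Monic ∧ g ∣ X ^ n - C lam ∧ D = generatedCode n g := by
  classical
  constructor
  · rintro ⟨I, hI⟩
    obtain ⟨g₀, hg₀⟩ := IsPrincipalIdealRing.principal
      (I.comap (Ideal.Quotient.mk (Ideal.span {(X ^ n - C lam : F[X])})))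
    have hmem : ∀ f : F[X],
        Ideal.Quotient.mk (Ideal.span {(X ^ n - C lam : F[X])}) f ∈ I ↔ g₀ ∣ f := by
      intro f
      rw [← Ideal.mem_comap, hg₀]
      exact Ideal.mem_span_singleton
    have hdvd : g₀ ∣ X ^ n - C lam := by
      rw [← hmem, Ideal.Quotient.eq_zero_iff_mem.mpr (Ideal.mem_span_singleton_self _)]
      exact I.zero_mem
    have hne : g₀ ≠ 0 := by
      rintro rfl
      exact (monic_X_pow_sub_C lam hn.ne').ne_zero (zero_dvd_iff.mp hdvd)
    refine ⟨normalize g₀, monic_normalize hne, (normalize_dvd_iff).mpr hdvd, ?_⟩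
    ext u
    rw [hI, hmem, mem_generatedCode, normalize_dvd_iff]
  · rintro ⟨g, -, hg, rfl⟩
    refine ⟨(Ideal.span {g}).map (Ideal.Quotient.mk _), fun u => ?_⟩
    rw [Ideal.mem_quotient_iff_mem, Ideal.mem_span_singleton, mem_generatedCode]
    rwa [Ideal.span_singleton_le_span_singleton]

theorem dvd_of_generatedCode_le (hn : 0 < n) {lam : F} {g g' : F[X]} (hg : g.Monic)
    (hgP : g ∣ X ^ n - C lam) (hg'P : g' ∣ X ^ n - C lam)
    (h : generatedCode n g ≤ generatedCode n g') : g' ∣ g := by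
  have hP : (X ^ n - C lam : F[X]).Monic := monic_X_pow_sub_C lam hn.ne'
  rcases lt_or_ge g.natDegree n with hlt | hge
  · obtain ⟨u, rfl⟩ := exists_vecPoly_eq (f := g)
      ((natDegree_lt_iff_degree_lt hg.ne_zero).mp hlt)
    exact h (mem_generatedCode.mpr dvd_rfl)
  · rwa [eq_of_dvd_of_natDegree_le_of_leadingCoeff hgP (by rwa [natDegree_X_pow_sub_C])
      (hg.leadingCoeff.trans hP.leadingCoeff.symm)]

theorem generatedCode_injOn (hn : 0 < n) (lam : F) :
    Set.InjOn (generatedCode n) {g : F[X] | g.Monic ∧ g ∣ X ^ n - C lam} := by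
  rintro g ⟨hg, hgP⟩ g' ⟨hg', hgP'⟩ h
  exact eq_of_monic_of_associated hg hg' (associated_of_dvd_dvd
    (dvd_of_generatedCode_le hn hg' hgP' hgP h.ge) (dvd_of_generatedCode_le hn hg hgP hgP' h.le))

/-! ### Euclidean duals and the LCD criterion -/

/-- The Euclidean product of two vectors is a coefficient of a product of polynomials. -/
theorem sum_mul_eq_coeff (u v : Fin n → F) :
    ∑ i, u i * v i = ((vecPoly u).reflect (n - 1) * vecPoly v).coeff (n - 1) := by
  rcases Nat.eq_zero_or_pos n with rfl | hn
  · simp [vecPoly]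
  rw [mul_comm, coeff_mul,
    Finset.Nat.sum_antidiagonal_eq_sum_range_succ_mk, Nat.succ_eq_add_one, Nat.sub_add_cancel hn,
    Finset.sum_range]
  refine Finset.sum_congr rfl fun i _ => ?_
  have hi := i.2
  rw [coeff_reflect, revAt_le (by omega), coeff_vecPoly, mul_comm,
    show n - 1 - (n - 1 - (i : ℕ)) = i by omega, coeff_vecPoly]

theorem coeff_eq_zero_of_X_pow_sub_C_dvd (hn : 0 < n) {lam : F} {A : F[X]}
    (hA : X ^ n - C lam ∣ A) (hdeg : A.natDegree ≤ 2 * (n - 1)) : A.coeff (n - 1) = 0 := by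
  obtain ⟨W, rfl⟩ := hA
  rcases eq_or_ne W 0 with rfl | hW
  · simp
  rw [natDegree_mul (monic_X_pow_sub_C lam hn.ne').ne_zero hW, natDegree_X_pow_sub_C] at hdeg
  rw [sub_mul, coeff_sub, coeff_X_pow_mul', if_neg (by omega), coeff_C_mul,
    coeff_eq_zero_of_natDegree_lt (by omega : W.natDegree < n - 1)]
  simp

/-- If `xⁿ - λ = g h`, the dual of the code generated by `g` is generated by the reciprocal polynomial
of `h`. -/
theorem euclideanDual_generatedCode (hn : 0 < n) {lam : F} (hl : lam ≠ 0) {g h : F[X]}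
    (hgh : g * h = X ^ n - C lam) :
    euclideanDual (generatedCode n g) = generatedCode n (reciprocal h) := by
  have hP : (X ^ n - C lam : F[X]).Monic := monic_X_pow_sub_C lam hn.ne'
  have hg0 : g ≠ 0 := by
    rintro rfl
    exact hP.ne_zero (by rw [← hgh, zero_mul])
  have hh : h.coeff 0 ≠ 0 := coeff_zero_ne_of_dvd (Dvd.intro_left g hgh)
    (by rw [coeff_zero_X_pow_sub_C hn]; exact neg_ne_zero.mpr hl)
  ext u
  rw [mem_generatedCode, reciprocal_dvd_iff_dvd_reflect (natDegree_vecPoly_le u) hh]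
  set U := (vecPoly u).reflect (n - 1) with hU
  have hUdeg : U.natDegree ≤ n - 1 :=
    natDegree_reflect_le.trans (max_le le_rfl (natDegree_vecPoly_le u))
  change (∀ v ∈ generatedCode n g, ∑ i, u i * v i = 0) ↔ _
  simp only [sum_mul_eq_coeff, ← hU, mem_generatedCode]
  constructor
  · intro hu
    suffices X ^ n - C lam ∣ g * U by
      rw [← hgh] at this
      exact (mul_dvd_mul_iff_left hg0).mp this
    rw [← modByMonic_eq_zero_iff_dvd hP]
    set R := g * U %ₘ (X ^ n - C lam) with hR
    by_contra hR0
    have hRdeg : R.natDegree < n := by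
      have := natDegree_modByMonic_lt (g * U) hP (by
        intro h1
        have := natDegree_X_pow_sub_C (n := n) (r := lam)
        rw [h1, natDegree_one] at this
        omega)
      rwa [natDegree_X_pow_sub_C] at this
    -- A shift of the codeword `g` detects the leading coefficient of `R`.
    set k := n - 1 - R.natDegree with hk
    obtain ⟨v, hv⟩ := exists_vecPoly_eq (n := n) (f := X ^ k * g %ₘ (X ^ n - C lam)) (by
      have := degree_modByMonic_lt (X ^ k * g) hP
      rwa [degree_X_pow_sub_C hn] at this)
    have e1 := modByMonic_add_div (X ^ k * g) (X ^ n - C lam)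
    have e2 := modByMonic_add_div (g * U) (X ^ n - C lam)
    rw [← hv] at e1
    rw [← hR] at e2
    have hgv : g ∣ vecPoly v := by
      rw [eq_sub_of_add_eq e1]
      exact dvd_sub (Dvd.intro_left _ rfl) ((Dvd.intro _ hgh).mul_right _)
    have hzero : (U * vecPoly v - X ^ k * R).coeff (n - 1) = 0 := by
      refine coeff_eq_zero_of_X_pow_sub_C_dvd hn (lam := lam)
        ⟨X ^ k * (g * U /ₘ (X ^ n - C lam)) - U * (X ^ k * g /ₘ (X ^ n - C lam)), ?_⟩ ?_
      · linear_combination U * e1 - X ^ k * e2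
      · have h1 : (U * vecPoly v).natDegree ≤ 2 * (n - 1) :=
          natDegree_mul_le.trans (by have := natDegree_vecPoly_le v; omega)
        have h2 : (X ^ k * R).natDegree ≤ 2 * (n - 1) :=
          natDegree_mul_le.trans (by rw [natDegree_X_pow]; omega)
        exact (natDegree_sub_le _ _).trans (max_le h1 h2)
    rw [coeff_sub, hu v hgv, zero_sub, neg_eq_zero, coeff_X_pow_mul', if_pos (by omega),
      show n - 1 - k = R.natDegree by omega] at hzero
    exact hR0 (leadingCoeff_eq_zero.mp hzero)
  · intro hu v hv
    refine coeff_eq_zero_of_X_pow_sub_C_dvd hn (lam := lam) ?_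
      (natDegree_mul_le.trans (by have := natDegree_vecPoly_le v; omega))
    rw [← hgh, mul_comm g]
    exact mul_dvd_mul hu hv

theorem isEuclideanLCD_generatedCode_iff_isCoprime (hn : 0 < n) {lam : F} (hl : lam ≠ 0)
    {g h : F[X]} (hgh : g * h = X ^ n - C lam) :
    IsEuclideanLCD (generatedCode n g) ↔ IsCoprime g (reciprocal h) := by
  classical
  have hP : (X ^ n - C lam : F[X]).Monic := monic_X_pow_sub_C lam hn.ne'
  have hg0 : g ≠ 0 := by
    rintro rfl
    exact hP.ne_zero (by rw [← hgh, zero_mul])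
  have hh : h.coeff 0 ≠ 0 := coeff_zero_ne_of_dvd (Dvd.intro_left g hgh)
    (by rw [coeff_zero_X_pow_sub_C hn]; exact neg_ne_zero.mpr hl)
  have hh0 : h ≠ 0 := by rintro rfl; simp at hh
  have hr0 : reciprocal h ≠ 0 := (reciprocal_monic hh).ne_zero
  have hdeg : g.natDegree + (reciprocal h).natDegree = n := by
    rw [natDegree_reciprocal hh, ← natDegree_mul hg0 hh0, hgh, natDegree_X_pow_sub_C]
  rw [IsEuclideanLCD, euclideanDual_generatedCode hn hl hgh, Submodule.eq_bot_iff]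
  simp only [Submodule.mem_inf, mem_generatedCode]
  constructor
  · intro H
    by_contra hnc
    -- If the gcd is not a unit, the lcm has degree below `n` and gives a nonzero common codeword.
    obtain ⟨a, ha⟩ := EuclideanDomain.gcd_dvd_left g (reciprocal h)
    obtain ⟨b, hb⟩ := EuclideanDomain.gcd_dvd_right g (reciprocal h)
    set d := EuclideanDomain.gcd g (reciprocal h) with hd
    have hda : d * a ≠ 0 := ha ▸ hg0
    have hdb : d * b ≠ 0 := hb ▸ hr0
    have hd0 := left_ne_zero_of_mul hda
    have ha0 := right_ne_zero_of_mul hda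
    have hb0 := right_ne_zero_of_mul hdb
    have hdpos : 0 < d.natDegree := by
      rw [Nat.pos_iff_ne_zero]
      intro h0
      exact hnc (EuclideanDomain.gcd_isUnit_iff.mp
        (isUnit_iff_degree_eq_zero.mpr ((degree_eq_iff_natDegree_eq hd0).mpr h0)))
    have hlt : (g * b).natDegree < n := by
      rw [natDegree_mul hg0 hb0]
      rw [hb, natDegree_mul hd0 hb0] at hdeg
      omega
    obtain ⟨u, hu⟩ := exists_vecPoly_eq
      ((natDegree_lt_iff_degree_lt (mul_ne_zero hg0 hb0)).mp hlt)
    have := H u ⟨hu ▸ ⟨b, rfl⟩, hu ▸ ⟨a, by linear_combination b * ha - a * hb⟩⟩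
    rw [← vecPoly_eq_zero, hu] at this
    exact mul_ne_zero hg0 hb0 this
  · rintro hc u ⟨h1, h2⟩
    rw [← vecPoly_eq_zero]
    refine eq_zero_of_dvd_of_degree_lt (hc.mul_dvd h1 h2) ((degree_vecPoly_lt u).trans_le ?_)
    rw [degree_eq_natDegree (mul_ne_zero hg0 hr0), natDegree_mul hg0 hr0, hdeg]

/-- For `λ ≠ λ⁻¹` the polynomials `xⁿ - λ` and `xⁿ - λ⁻¹`, which the generators of a code and of its
dual divide, are coprime. -/
theorem isEuclideanLCD_of_ne (hn : 0 < n) {lam : F} (hl : lam ≠ 0) (h1 : lam ≠ 1) (h2 : lam ≠ -1)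
    {D : Submodule F (Fin n → F)} (hD : IsConstacyclic lam D) : IsEuclideanLCD D := by
  obtain ⟨g, -, ⟨h, hgh⟩, rfl⟩ := (isConstacyclic_iff_exists_generator hn lam D).mp hD
  rw [isEuclideanLCD_generatedCode_iff_isCoprime hn hl hgh.symm]
  have hne : lam⁻¹ - lam ≠ 0 := by
    intro h0
    have hsq : lam * lam = 1 := by
      rw [sub_eq_zero] at h0
      nth_rewrite 1 [← h0]
      exact inv_mul_cancel₀ hl
    rcases mul_self_eq_one_iff.mp hsq with h | h
    · exact h1 h
    · exact h2 h
  have hc : IsCoprime (X ^ n - C lam : F[X]) (X ^ n - C lam⁻¹) := by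
    refine ⟨C (lam⁻¹ - lam)⁻¹, -C (lam⁻¹ - lam)⁻¹, ?_⟩
    have : (C (lam⁻¹ - lam)⁻¹ * C (lam⁻¹ - lam) : F[X]) = 1 := by
      rw [← C_mul, inv_mul_cancel₀ hne, C_1]
    rw [C_sub] at this
    linear_combination this
  refine (hc.of_isCoprime_of_dvd_left (Dvd.intro _ hgh.symm)).of_isCoprime_of_dvd_right ?_
  rw [← reciprocal_X_pow_sub_C hn hl]
  exact reciprocal_dvd_reciprocal (Dvd.intro_left _ hgh.symm)

theorem isEuclideanLCD_generatedCode_iff_isSelfReciprocal (hn : 0 < n) (hnF : (n : F) ≠ 0)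
    {lam : F} (hl : lam * lam = 1) {g : F[X]} (hg : g.Monic) (hgP : g ∣ X ^ n - C lam) :
    IsEuclideanLCD (generatedCode n g) ↔ IsSelfReciprocal g := by
  have hl0 : lam ≠ 0 := by rintro rfl; simp at hl
  have hinv : lam⁻¹ = lam := inv_eq_of_mul_eq_one_left hl
  have hP0 : (X ^ n - C lam : F[X]).coeff 0 ≠ 0 := by
    rw [coeff_zero_X_pow_sub_C hn]; exact neg_ne_zero.mpr hl0
  obtain ⟨h, hgh⟩ := hgP
  have hg0 := coeff_zero_ne_of_dvd (Dvd.intro _ hgh.symm) hP0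
  have hrec : reciprocal g * reciprocal h = X ^ n - C lam := by
    rw [← reciprocal_mul, ← hgh, reciprocal_X_pow_sub_C hn hl0, hinv]
  rw [isEuclideanLCD_generatedCode_iff_isCoprime hn hl0 hgh.symm]
  constructor
  · intro hc
    refine ⟨hg, hg0, eq_of_dvd_of_natDegree_le_of_leadingCoeff
      (hc.dvd_of_dvd_mul_right ?_) (natDegree_reciprocal hg0).le
      (hg.leadingCoeff.trans (reciprocal_monic hg0).leadingCoeff.symm)⟩
    rw [hrec, hgh]
    exact Dvd.intro _ rfl
  · rintro ⟨-, -, hs⟩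
    have hsep : (X ^ n - C lam : F[X]).Separable := (X_pow_sub_C_separable_iff hn hl0).mpr hnF
    rw [← hrec, ← hs] at hsep
    exact hsep.isCoprime

end Codes

/-! ### Subsets invariant under an involution -/

section Involution

variable {α : Type*} [Fintype α]

/-- The orbit relation of an involution. -/
def involutionSetoid {σ : α → α} (hσ : Function.Involutive σ) : Setoid α where
  r a b := b = a ∨ b = σ a
  iseqv := {
    refl := fun _ => Or.inl rfl
    symm := by
      rintro a b (rfl | rfl)
      · exact Or.inl rfl
      · exact Or.inr (hσ a).symm
    trans := by
      rintro a b c (rfl | rfl) (rfl | rfl)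
      · exact Or.inl rfl
      · exact Or.inr rfl
      · exact Or.inr rfl
      · exact Or.inl (hσ a) }

open Classical in
/-- An orbit has either two points, none of them fixed, or one point, which is fixed. -/
theorem card_add_card_fixed_eq {σ : α → α} (hσ : Function.Involutive σ) :
    Fintype.card α + (Finset.univ.filter fun a => σ a = a).card =
      2 * Nat.card (Quotient (involutionSetoid hσ)) := by
  have hmk : ∀ a b : α, (Quotient.mk (involutionSetoid hσ) b = Quotient.mk _ a) ↔
      (a = b ∨ a = σ b) := fun a b => Quotient.eq (r := involutionSetoid hσ)
  rw [Nat.card_eq_fintype_card, ← Finset.card_univ,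
    Finset.card_eq_sum_card_fiberwise (f := Quotient.mk (involutionSetoid hσ))
      (t := Finset.univ) (fun _ _ => Finset.mem_coe.mpr (Finset.mem_univ _)),
    Finset.card_eq_sum_card_fiberwise (s := Finset.univ.filter fun a => σ a = a)
      (f := Quotient.mk (involutionSetoid hσ))
      (t := Finset.univ) (fun _ _ => Finset.mem_coe.mpr (Finset.mem_univ _)),
    ← Finset.sum_add_distrib, ← Finset.card_univ, mul_comm, ← smul_eq_mul, ← Finset.sum_const]
  refine Finset.sum_congr rfl fun q _ => ?_
  induction q using Quotient.inductionOn with | _ a => ?_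
  have e1 : (Finset.univ.filter fun b => Quotient.mk (involutionSetoid hσ) b = Quotient.mk _ a) =
      {a, σ a} := by
    ext b
    simp only [Finset.mem_filter, Finset.mem_univ, true_and, hmk, Finset.mem_insert,
      Finset.mem_singleton]
    constructor
    · rintro (h | h)
      · exact Or.inl h.symm
      · exact Or.inr (by rw [h, hσ b])
    · rintro (h | h)
      · exact Or.inl h.symm
      · exact Or.inr (by rw [h, hσ a])
  rw [Finset.filter_filter, show (Finset.univ.filter fun b => σ b = b ∧
      Quotient.mk (involutionSetoid hσ) b = Quotient.mk _ a) =
      ({a, σ a} : Finset α).filter (fun b => σ b = b) by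
        rw [← e1, Finset.filter_filter]; simp only [and_comm], e1]
  by_cases h : σ a = a
  · simp [h, Finset.filter_singleton]
  · have h' : a ≠ σ a := fun h1 => h h1.symm
    rw [Finset.card_pair h', Finset.filter_insert, Finset.filter_singleton, if_neg h,
      if_neg (by rwa [hσ a])]
    simp

theorem ncard_invariant_sets {σ : α → α} (hσ : Function.Involutive σ) :
    {S : Set α | ∀ a ∈ S, σ a ∈ S}.ncard =
      2 ^ Nat.card (Quotient (involutionSetoid hσ)) := by
  classical
  have : {S : Set α | ∀ a ∈ S, σ a ∈ S} =
      Set.range (fun T : Set (Quotient (involutionSetoid hσ)) => Quotient.mk _ ⁻¹' T) := by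
    ext S
    constructor
    · intro hS
      refine ⟨Quotient.mk _ '' S, ?_⟩
      ext a
      constructor
      · rintro ⟨b, hb, hba⟩
        rcases Quotient.eq (r := involutionSetoid hσ).mp hba with h | h
        · exact h ▸ hb
        · exact h ▸ hS b hb
      · exact fun ha => ⟨a, ha, rfl⟩
    · rintro ⟨T, rfl⟩ a ha
      have : Quotient.mk (involutionSetoid hσ) (σ a) = Quotient.mk _ a :=
        Quotient.eq (r := involutionSetoid hσ).mpr (Or.inr (hσ a).symm)
      simpa only [Set.mem_preimage, this] using ha
  rw [this, ← Set.image_univ,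
    Set.ncard_image_of_injective _ (Set.preimage_injective.mpr Quotient.mk_surjective),
    Set.ncard_univ, Nat.card_eq_fintype_card, Fintype.card_set, Nat.card_eq_fintype_card]

end Involution

/-! ### Self-reciprocal divisors of `xⁿ - λ` -/

section Divisors

variable {F : Type*} [Field F] {n : ℕ}

theorem irredFactors_finite (hn : 0 < n) (lam : F) : (irredFactors n lam).Finite := by
  classical
  refine (UniqueFactorizationMonoid.normalizedFactors (X ^ n - C lam : F[X])).toFinset.finite_toSet.subset
    fun f ⟨hm, hi, hd⟩ => ?_
  rw [Finset.mem_coe, Multiset.mem_toFinset, UniqueFactorizationMonoid.mem_normalizedFactors_iff'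
    (monic_X_pow_sub_C lam hn.ne').ne_zero]
  exact ⟨hi, hm.normalize_eq_self, hd⟩

theorem coeff_zero_ne_of_mem_irredFactors (hn : 0 < n) {lam : F} (hl : lam * lam = 1) {f : F[X]}
    (hf : f ∈ irredFactors n lam) : f.coeff 0 ≠ 0 := by
  refine coeff_zero_ne_of_dvd hf.2.2 ?_
  rw [coeff_zero_X_pow_sub_C hn, neg_ne_zero]
  rintro rfl
  simp at hl

theorem reciprocal_mem_irredFactors (hn : 0 < n) {lam : F} (hl : lam * lam = 1) {f : F[X]}
    (hf : f ∈ irredFactors n lam) : reciprocal f ∈ irredFactors n lam := by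
  have h0 := coeff_zero_ne_of_mem_irredFactors hn hl hf
  refine ⟨reciprocal_monic h0, irreducible_reciprocal hf.2.1 hf.1 h0, ?_⟩
  have := reciprocal_dvd_reciprocal hf.2.2
  rwa [reciprocal_X_pow_sub_C hn (by rintro rfl; simp at hl),
    inv_eq_of_mul_eq_one_left hl] at this

/-- Passing to the reciprocal polynomial, on the monic irreducible factors of `xⁿ - λ`, `λ² = 1`. -/
noncomputable def reciprocalFactor (hn : 0 < n) {lam : F} (hl : lam * lam = 1) (f : irredFactors n lam) :
    irredFactors n lam :=
  ⟨reciprocal f, reciprocal_mem_irredFactors hn hl f.2⟩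

theorem reciprocalFactor_involutive (hn : 0 < n) {lam : F} (hl : lam * lam = 1) :
    Function.Involutive (reciprocalFactor hn hl) := fun f =>
  Subtype.ext (reciprocal_reciprocal f.2.1 (coeff_zero_ne_of_mem_irredFactors hn hl f.2))

theorem eq_of_mem_irredFactors_of_dvd {lam : F} {f g : F[X]} (hf : f ∈ irredFactors n lam)
    (hg : g ∈ irredFactors n lam) (h : f ∣ g) : f = g :=
  eq_of_monic_of_associated hf.1 hg.1 (hf.2.1.associated_of_dvd hg.2.1 h)

theorem squarefree_X_pow_sub_C (hn : 0 < n) (hnF : (n : F) ≠ 0) {lam : F} (hl : lam * lam = 1) :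
    Squarefree (X ^ n - C lam : F[X]) :=
  ((X_pow_sub_C_separable_iff hn (by rintro rfl; simp at hl)).mpr hnF).squarefree

/-- A monic divisor of the squarefree polynomial `xⁿ - λ` is determined by its irreducible factors. -/
theorem dvd_of_forall_irredFactors_dvd (hn : 0 < n) (hnF : (n : F) ≠ 0) {lam : F}
    (hl : lam * lam = 1) {g g' : F[X]} (hg : g ∣ X ^ n - C lam)
    (h : ∀ f ∈ irredFactors n lam, f ∣ g → f ∣ g') : g ∣ g' := by
  classical
  have hP : (X ^ n - C lam : F[X]) ≠ 0 := (monic_X_pow_sub_C lam hn.ne').ne_zero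
  have hg0 : g ≠ 0 := ne_zero_of_dvd_ne_zero hP hg
  rcases eq_or_ne g' 0 with rfl | hg'
  · exact dvd_zero g
  rw [UniqueFactorizationMonoid.dvd_iff_normalizedFactors_le_normalizedFactors hg0 hg',
    Multiset.le_iff_subset ((UniqueFactorizationMonoid.squarefree_iff_nodup_normalizedFactors
      hg0).mp ((squarefree_X_pow_sub_C hn hnF hl).squarefree_of_dvd hg))]
  intro f hf
  rw [UniqueFactorizationMonoid.mem_normalizedFactors_iff' hg0] at hf
  rw [UniqueFactorizationMonoid.mem_normalizedFactors_iff' hg']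
  have hm : f.Monic := hf.2.1 ▸ monic_normalize hf.1.ne_zero
  exact ⟨hf.1, hf.2.1, h f ⟨hm, hf.1, hf.2.2.trans hg⟩ hf.2.2⟩

/-- The self-reciprocal divisors of `xⁿ - λ` correspond to the sets of irreducible factors
that are closed under taking reciprocals. -/
theorem ncard_selfReciprocal_divisors (hn : 0 < n) (hnF : (n : F) ≠ 0) {lam : F}
    (hl : lam * lam = 1) :
    {g : F[X] | (g.Monic ∧ g ∣ X ^ n - C lam) ∧ IsSelfReciprocal g}.ncard =
      {S : Set (irredFactors n lam) | ∀ a ∈ S, reciprocalFactor hn hl a ∈ S}.ncard := by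
  classical
  have := (irredFactors_finite hn lam).fintype
  refine Set.ncard_congr (fun g _ => {f : irredFactors n lam | (f : F[X]) ∣ g}) ?_ ?_ ?_
  · rintro g ⟨-, -, -, hs⟩ f hf
    change reciprocal (f : F[X]) ∣ g
    rw [hs]
    exact reciprocal_dvd_reciprocal hf
  · rintro g g' ⟨⟨hm, hd⟩, -⟩ ⟨⟨hm', hd'⟩, -⟩ h
    have h' : ∀ f : irredFactors n lam, (f : F[X]) ∣ g ↔ (f : F[X]) ∣ g' := fun f => by
      simpa using congrArg (f ∈ ·) h
    exact eq_of_monic_of_associated hm hm' (associated_of_dvd_dvd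
      (dvd_of_forall_irredFactors_dvd hn hnF hl hd fun f hf => (h' ⟨f, hf⟩).mp)
      (dvd_of_forall_irredFactors_dvd hn hnF hl hd' fun f hf => (h' ⟨f, hf⟩).mpr))
  · intro S hS
    set g : F[X] := ∏ f ∈ S.toFinset, (f : F[X]) with hg
    have hmem : ∀ f : irredFactors n lam, (f : F[X]) ∣ g ↔ f ∈ S := by
      intro f
      constructor
      · intro hf
        obtain ⟨k, hk, hfk⟩ := f.2.2.1.prime.exists_mem_finset_dvd hf
        rw [Subtype.ext (eq_of_mem_irredFactors_of_dvd f.2 k.2 hfk)]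
        simpa using hk
      · intro hf
        exact Finset.dvd_prod_of_mem _ (by simpa using hf)
    have hm : g.Monic := monic_prod_of_monic _ _ fun f _ => f.2.1
    have hd : g ∣ X ^ n - C lam := by
      refine Finset.prod_dvd_of_coprime (fun f _ k _ hfk => ?_) fun f _ => f.2.2.2
      refine (f.2.2.1.coprime_iff_not_dvd).mpr fun h => hfk ?_
      exact Subtype.ext (eq_of_mem_irredFactors_of_dvd f.2 k.2 h)
    have h0 : g.coeff 0 ≠ 0 := coeff_zero_ne_of_dvd hd (by
      rw [coeff_zero_X_pow_sub_C hn, neg_ne_zero]; rintro rfl; simp at hl)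
    refine ⟨g, ⟨⟨hm, hd⟩, hm, h0, ?_⟩, Set.ext hmem⟩
    refine eq_of_dvd_of_natDegree_le_of_leadingCoeff ?_ (natDegree_reciprocal h0).le
      (hm.leadingCoeff.trans (reciprocal_monic h0).leadingCoeff.symm)
    refine dvd_of_forall_irredFactors_dvd hn hnF hl hd fun f hf hfg => ?_
    have := (hmem _).mpr (hS ⟨f, hf⟩ ((hmem ⟨f, hf⟩).mp hfg))
    have := reciprocal_dvd_reciprocal this
    rwa [reciprocalFactor,
      reciprocal_reciprocal hf.1 (coeff_zero_ne_of_mem_irredFactors hn hl hf)] at this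

/-- `N₁ + N₂` is twice the number of orbits of `f ↦ f*` on the irreducible factors. -/
theorem N₁_add_N₂_eq (hn : 0 < n) {lam : F} (hl : lam * lam = 1) [Fintype (irredFactors n lam)] :
    N₁ n lam + N₂ n lam =
      2 * Nat.card (Quotient (involutionSetoid (reciprocalFactor_involutive hn hl))) := by
  classical
  rw [← card_add_card_fixed_eq, N₁, N₂, ← Nat.card_coe_set_eq, Nat.card_eq_fintype_card]
  congr 1
  rw [← Set.ncard_coe_finset, ← Set.ncard_image_of_injective _ Subtype.val_injective]
  congr 1
  ext f
  simp only [Set.mem_ofPred_eq, Set.mem_image, Finset.coe_filter, Finset.mem_univ, true_and,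
    Subtype.exists, exists_and_right, exists_eq_right]
  constructor
  · rintro ⟨hf, hs⟩
    exact ⟨hf, Subtype.ext hs.2.2.symm⟩
  · rintro ⟨hf, hs⟩
    exact ⟨hf, hf.1, coeff_zero_ne_of_mem_irredFactors hn hl hf, (congrArg Subtype.val hs).symm⟩

theorem even_and_ncard_LCD (hn : 0 < n) (hnF : (n : F) ≠ 0) {lam : F} (hl : lam * lam = 1) :
    Even (N₁ n lam + N₂ n lam) ∧
      {D : Submodule F (Fin n → F) | IsConstacyclic lam D ∧ IsEuclideanLCD D}.ncard =
        2 ^ ((N₁ n lam + N₂ n lam) / 2) := by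
  have := (irredFactors_finite hn lam).fintype
  have hN := N₁_add_N₂_eq hn hl
  refine ⟨hN ▸ even_two_mul _, ?_⟩
  have himg : {D : Submodule F (Fin n → F) | IsConstacyclic lam D ∧ IsEuclideanLCD D} =
      generatedCode n '' {g : F[X] | (g.Monic ∧ g ∣ X ^ n - C lam) ∧ IsSelfReciprocal g} := by
    ext D
    constructor
    · rintro ⟨hD, hL⟩
      obtain ⟨g, hg, hgP, rfl⟩ := (isConstacyclic_iff_exists_generator hn lam D).mp hD
      exact ⟨g, ⟨⟨hg, hgP⟩,
        (isEuclideanLCD_generatedCode_iff_isSelfReciprocal hn hnF hl hg hgP).mp hL⟩, rfl⟩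
    · rintro ⟨g, ⟨⟨hg, hgP⟩, hs⟩, rfl⟩
      exact ⟨(isConstacyclic_iff_exists_generator hn lam _).mpr ⟨g, hg, hgP, rfl⟩,
        (isEuclideanLCD_generatedCode_iff_isSelfReciprocal hn hnF hl hg hgP).mpr hs⟩
  rw [himg, Set.InjOn.ncard_image ((generatedCode_injOn hn lam).mono fun g hg => hg.1),
    ncard_selfReciprocal_divisors hn hnF hl,
    ncard_invariant_sets (reciprocalFactor_involutive hn hl), hN, Nat.mul_div_cancel_left _ two_pos]

end Divisors

/-! ### Irreducible factors of cyclotomic polynomials -/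

section Cyclotomic

variable {F : Type*} [Field F]

/-- The monic irreducible factors of the `m`-th cyclotomic polynomial. -/
def cyclotomicFactors (F : Type*) [Field F] (m : ℕ) : Set F[X] :=
  {f | f.Monic ∧ Irreducible f ∧ f ∣ cyclotomic m F}

theorem cyclotomicFactors_finite (m : ℕ) : (cyclotomicFactors F m).Finite := by
  classical
  refine (UniqueFactorizationMonoid.normalizedFactors (cyclotomic m F)).toFinset.finite_toSet.subset
    fun f ⟨hm, hi, hd⟩ => ?_
  rw [Finset.mem_coe, Multiset.mem_toFinset, UniqueFactorizationMonoid.mem_normalizedFactors_iff'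
    (cyclotomic_ne_zero m F)]
  exact ⟨hi, hm.normalize_eq_self, hd⟩

variable [Fintype F]

theorem natCast_ne_zero_of_coprime_card {m : ℕ} (hm : m.Coprime (Fintype.card F)) :
    (m : F) ≠ 0 := by
  obtain ⟨p, hp⟩ := CharP.exists F
  have hpp : p.Prime := (CharP.char_is_prime_or_zero F p).resolve_right
    (CharP.char_ne_zero_of_finite F p)
  intro h
  have h1 : p ∣ m := (CharP.cast_eq_zero_iff F p m).mp h
  have h2 : p ∣ Fintype.card F :=
    (CharP.cast_eq_zero_iff F p _).mp (FiniteField.cast_card_eq_zero F)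
  exact hpp.one_lt.ne' (Nat.dvd_one.mp (hm ▸ Nat.dvd_gcd h1 h2))

theorem isRoot_isPrimitiveRoot {m : ℕ} (hm : m.Coprime (Fintype.card F)) {K : Type*} [Field K]
    [Algebra F K] {f : F[X]} (hf : f ∣ cyclotomic m F) {α : K} (hα : aeval α f = 0) :
    IsPrimitiveRoot α m := by
  have : NeZero (m : K) := by
    refine ⟨?_⟩
    rw [← map_natCast (algebraMap F K)]
    exact (_root_.map_ne_zero _).mpr (natCast_ne_zero_of_coprime_card hm)
  rw [← isRoot_cyclotomic_iff, ← map_cyclotomic m (algebraMap F K), IsRoot.def, eval_map_algebraMap]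
  obtain ⟨k, hk⟩ := hf
  rw [hk, map_mul, hα, zero_mul]

theorem cyclotomicFactors_disjoint {m m' : ℕ} (hm : m.Coprime (Fintype.card F))
    (hm' : m'.Coprime (Fintype.card F)) (h : m ≠ m') :
    Disjoint (cyclotomicFactors F m) (cyclotomicFactors F m') := by
  rw [Set.disjoint_left]
  rintro f ⟨-, hi, hd⟩ ⟨-, -, hd'⟩
  have : Fact (Irreducible f) := ⟨hi⟩
  have hroot : aeval (AdjoinRoot.root f) f = 0 := by simp
  exact h ((isRoot_isPrimitiveRoot hm hd hroot).unique (isRoot_isPrimitiveRoot hm' hd' hroot))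

theorem ordMod_eq_orderOf_unit {m q : ℕ} (h : q.Coprime m) :
    ordMod m q = orderOf (ZMod.unitOfCoprime q h) := by
  rw [ordMod, ← orderOf_units, ZMod.coe_unitOfCoprime]

theorem ordMod_pos {m q : ℕ} (hm : 0 < m) (h : q.Coprime m) : 0 < ordMod m q := by
  have : NeZero m := ⟨hm.ne'⟩
  rw [ordMod_eq_orderOf_unit h]
  exact orderOf_pos _

/-- The irreducible factors of `Φ_m` all have degree `ord_m(q)`. -/
theorem ncard_cyclotomicFactors {m : ℕ} (hm0 : 0 < m) (hm : m.Coprime (Fintype.card F)) :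
    ((cyclotomicFactors F m).ncard : ℚ) = m.totient / ordMod m (Fintype.card F) := by
  classical
  obtain ⟨p, hp⟩ := CharP.exists F
  obtain ⟨k, hpp, hcard⟩ := FiniteField.card F p
  have : Fact p.Prime := ⟨hpp⟩
  have hcop : p.Coprime m := by
    rw [hcard] at hm
    exact ((Nat.coprime_pow_right_iff k.pos _ _).mp hm).symm
  have heq : cyclotomicFactors F m =
      (UniqueFactorizationMonoid.normalizedFactors (cyclotomic m F)).toFinset := by
    ext f
    rw [Finset.mem_coe, Multiset.mem_toFinset, UniqueFactorizationMonoid.mem_normalizedFactors_iff'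
      (cyclotomic_ne_zero m F)]
    constructor
    · rintro ⟨h1, h2, h3⟩
      exact ⟨h2, h1.normalize_eq_self, h3⟩
    · rintro ⟨h1, h2, h3⟩
      exact ⟨h2 ▸ monic_normalize h1.ne_zero, h1, h3⟩
  have hord := ordMod_eq_orderOf_unit hm.symm
  have : NeZero m := ⟨hm0.ne'⟩
  have hdvd : ordMod m (Fintype.card F) ∣ m.totient := by
    rw [hord, ← ZMod.card_units_eq_totient]
    exact orderOf_dvd_card
  rw [heq, Set.ncard_coe_finset, normalizedFactors_cyclotomic_card hcard hcop,
    ← Nat.cast_div hdvd (by exact_mod_cast (ordMod_pos hm0 hm.symm).ne'), hord]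
  congr 3
  ext
  simp [hcard]

/-- The conjugates of a root `α` of an irreducible factor of `Φ_m` are the powers `α^(q^w)`, so
`α⁻¹` is one of them exactly when `q^w ≡ -1` modulo `m` for some `w`. -/
theorem isSelfReciprocal_iff_exists_pow {m : ℕ} (hm0 : 0 < m) (hm : m.Coprime (Fintype.card F))
    {f : F[X]} (hf : f ∈ cyclotomicFactors F m) :
    IsSelfReciprocal f ↔
      ∃ w : ℕ, 0 < w ∧ ((Fintype.card F : ℕ) : ℤ) ^ w ≡ -1 [ZMOD (m : ℤ)] := by
  obtain ⟨hmon, hirr, hdvd⟩ := hf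
  have : Fact (Irreducible f) := ⟨hirr⟩
  have := hmon.finite_adjoinRoot
  have : Finite (AdjoinRoot f) := Module.finite_of_finite F
  set α := AdjoinRoot.root f with hα
  have hroot : aeval α f = 0 := by simp [hα]
  have hprim := isRoot_isPrimitiveRoot hm hdvd hroot
  have hα0 : α ≠ 0 := hprim.ne_zero hm0.ne'
  have hf0 : f.coeff 0 ≠ 0 := by
    intro h0
    have hX : X ∣ f := X_dvd_iff.mpr h0
    obtain ⟨k, hk⟩ := hX.trans hdvd
    have h1 : IsPrimitiveRoot (0 : F) m :=
      isRoot_isPrimitiveRoot (K := F) hm (f := X) ⟨k, hk⟩ (by simp)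
    exact h1.ne_zero hm0.ne' rfl
  have hmin : minpoly F α = f :=
    (minpoly.eq_of_irreducible_of_monic hirr hroot hmon).symm
  -- `α ^ (q ^ w) = α⁻¹` is the congruence `q ^ w ≡ -1`.
  have hpow : ∀ w : ℕ, α ^ (Fintype.card F ^ w) = α⁻¹ ↔
      ((Fintype.card F : ℕ) : ℤ) ^ w ≡ -1 [ZMOD (m : ℤ)] := by
    intro w
    rw [← mul_eq_one_iff_eq_inv₀ hα0, ← pow_succ, hprim.pow_eq_one_iff_dvd, Int.modEq_comm,
      Int.modEq_iff_dvd, ← Int.natCast_dvd_natCast]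
    push_cast
    rw [sub_neg_eq_add]
  -- `α⁻¹` is a root of the irreducible polynomial `f*`.
  have hself : IsSelfReciprocal f ↔ aeval α⁻¹ f = 0 := by
    have hinv : aeval α⁻¹ (reciprocal f) = 0 := by
      let _ := invertibleOfNonzero hα0
      have := (eval₂_reverse_eq_zero_iff (algebraMap F (AdjoinRoot f)) α f).mpr hroot
      rw [invOf_eq_inv] at this
      rw [reciprocal, map_mul, aeval_def α⁻¹ f.reverse, this, mul_zero]
    have hmin' : minpoly F α⁻¹ = reciprocal f := (minpoly.eq_of_irreducible_of_monic
      (irreducible_reciprocal hirr hmon hf0) hinv (reciprocal_monic hf0)).symm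
    constructor
    · rintro ⟨-, -, h⟩
      exact (congrArg (aeval α⁻¹) h).trans hinv
    · intro h
      refine ⟨hmon, hf0, ?_⟩
      rw [← hmin']
      exact minpoly.eq_of_irreducible_of_monic hirr h hmon
  have hfrob : ∀ (w : ℕ) (x : AdjoinRoot f),
      (FiniteField.frobeniusAlgEquivOfAlgebraic F (AdjoinRoot f) ^ w) x =
        x ^ (Fintype.card F ^ w) := by
    intro w x
    simp [AlgEquiv.coe_pow, FiniteField.coe_frobeniusAlgEquivOfAlgebraic, pow_iterate]
  rw [hself]
  constructor
  · intro h
    have hconj : IsConjRoot F α α⁻¹ := by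
      rw [isConjRoot_iff_aeval_eq_zero (Algebra.IsIntegral.isIntegral α), hmin]
      exact h
    obtain ⟨σ, hσ⟩ := isConjRoot_iff_exists_algEquiv.mp hconj
    obtain ⟨w, hw⟩ := (FiniteField.bijective_frobeniusAlgEquivOfAlgebraic_pow F (AdjoinRoot f)).2 σ⁻¹
    have hw' : α ^ (Fintype.card F ^ (w : ℕ)) = α⁻¹ := by
      rw [← hfrob]
      change (fun k : Fin _ =>
        FiniteField.frobeniusAlgEquivOfAlgebraic F (AdjoinRoot f) ^ (k : ℕ)) w α = _
      rw [hw]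
      exact σ.symm_apply_eq.mpr hσ.symm
    -- Adding the order of Frobenius makes the exponent positive.
    refine ⟨w + Module.finrank F (AdjoinRoot f),
      Nat.add_pos_right _ Module.finrank_pos, (hpow _).mp ?_⟩
    rw [pow_add, pow_mul, hw', ← hfrob, ← FiniteField.orderOf_frobeniusAlgEquivOfAlgebraic,
      pow_orderOf_eq_one, AlgEquiv.one_apply]
  · rintro ⟨w, -, hw⟩
    rw [← (hpow w).mpr hw, ← hfrob, aeval_algHom_apply, hroot, map_zero]

end Cyclotomic

/-! ### The factorization of `xⁿ - λ` for `λ = ±1` -/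

section Formulas

variable {F : Type*} [Field F]

theorem orderOf_eq_two_of_eq_neg_one {lam : F} (h : lam = -1) (h1 : lam ≠ 1) : orderOf lam = 2 := by
  subst h
  refine orderOf_eq_prime (by ring) h1

theorem irredFactors_eq_biUnion {n : ℕ} {lam : F} {s : Finset ℕ} {c : ℕ → ℕ}
    (h : ∏ d ∈ s, cyclotomic (c d) F = X ^ n - C lam) :
    irredFactors n lam = ⋃ d ∈ s, cyclotomicFactors F (c d) := by
  ext f
  simp only [Set.mem_iUnion, irredFactors, cyclotomicFactors, Set.mem_ofPred_eq, exists_prop]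
  constructor
  · rintro ⟨hm, hi, hd⟩
    rw [← h] at hd
    obtain ⟨d, hds, hd⟩ := hi.prime.exists_mem_finset_dvd hd
    exact ⟨d, hds, hm, hi, hd⟩
  · rintro ⟨d, hds, hm, hi, hd⟩
    exact ⟨hm, hi, hd.trans (h ▸ Finset.dvd_prod_of_mem _ hds)⟩

/-- `xⁿ - λ` is the product of the cyclotomic polynomials `Φ_{r d n₁}` with `d ∣ n₂`. -/
theorem prod_cyclotomic_eq {n n₁ n₂ : ℕ} (hn : 0 < n) {lam : F} (hl : lam = 1 ∨ lam = -1)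
    (hnn : n = n₁ * n₂) (hprime : ∀ p : ℕ, p.Prime → p ∣ n₁ → p ∣ orderOf lam)
    (hcop : n₂.Coprime (orderOf lam)) :
    (∏ d ∈ n₂.divisors, cyclotomic (orderOf lam * d * n₁) F = X ^ n - C lam) ∧
      ∀ d ∈ n₂.divisors, (orderOf lam * d * n₁).totient = n₁ * d.totient := by
  have hn₁ : n₁ ≠ 0 := by rintro rfl; simp at hnn; omega
  have hn₂ : n₂ ≠ 0 := by rintro rfl; simp at hnn; omega
  by_cases h1 : lam = 1
  · subst h1
    rw [orderOf_one] at *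
    have : n₁ = 1 := by
      by_contra hne
      obtain ⟨p, hp, hpd⟩ := Nat.exists_prime_and_dvd hne
      exact hp.one_lt.ne' (Nat.dvd_one.mp (hprime p hp hpd))
    subst this
    rw [one_mul] at hnn
    subst hnn
    simp only [one_mul, mul_one, C_1]
    exact ⟨prod_cyclotomic_eq_X_pow_sub_one hn F, fun _ _ => trivial⟩
  · have hl' := hl.resolve_left h1
    rw [orderOf_eq_two_of_eq_neg_one hl' h1] at *
    set a := n₁.primeFactorsList.length
    have hpow : n₁ = 2 ^ a := Nat.eq_prime_pow_of_unique_prime_dvd hn₁ fun {p} hp hpd =>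
      (Nat.prime_dvd_prime_iff_eq hp Nat.prime_two).mp (hprime p hp hpd)
    have hodd : ∀ d, d ∣ n₂ → Nat.Coprime 2 d := fun d hd =>
      (Nat.Coprime.coprime_dvd_left hd hcop).symm
    refine ⟨?_, fun d hd => ?_⟩
    · -- Divide `x^{2n} - 1 = (xⁿ - 1)(xⁿ + 1)` by `xⁿ - 1`.
      have hset : (2 * n).divisors \ n.divisors =
          n₂.divisors.image fun d => 2 * d * n₁ := by
        ext m
        simp only [Finset.mem_sdiff, Nat.mem_divisors, Finset.mem_image]
        constructor
        · rintro ⟨⟨hm, -⟩, hm'⟩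
          have hm' : ¬ m ∣ n := fun h => hm' ⟨h, hn.ne'⟩
          rw [hnn, hpow, ← mul_assoc, ← pow_succ'] at hm
          obtain ⟨x, d, hx, hd, rfl⟩ := Nat.dvd_mul.mp hm
          obtain ⟨b, hb, rfl⟩ := (Nat.dvd_prime_pow Nat.prime_two).mp hx
          rcases Nat.lt_or_ge a b with hab | hab
          · obtain rfl : b = a + 1 := by omega
            refine ⟨d, ⟨hd, hn₂⟩, ?_⟩
            rw [hpow]
            ring
          · refine absurd ?_ hm'
            rw [hnn, hpow]
            exact mul_dvd_mul (pow_dvd_pow 2 hab) hd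
        · rintro ⟨d, ⟨hd, -⟩, rfl⟩
          refine ⟨⟨?_, by omega⟩, fun ⟨h, _⟩ => ?_⟩
          · rw [hnn, mul_assoc, mul_comm d]
            exact mul_dvd_mul_left 2 (mul_dvd_mul_left n₁ hd)
          · rw [hnn, mul_comm] at h
            have h2 := Nat.dvd_of_mul_dvd_mul_left (Nat.pos_of_ne_zero hn₁) h
            have := (Nat.Coprime.eq_one_of_dvd (hodd n₂ dvd_rfl) ((Nat.dvd_mul_right 2 d).trans h2))
            omega
      have hX : (X ^ n - 1 : F[X]) ≠ 0 := by
        rw [← C_1]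
        exact (monic_X_pow_sub_C (1 : F) hn.ne').ne_zero
      refine mul_right_cancel₀ hX ?_
      have hprod := prod_cyclotomic_eq_X_pow_sub_one (R := F) (by omega : 0 < 2 * n)
      rw [← Finset.prod_sdiff (Nat.divisors_subset_of_dvd (by omega) (Nat.dvd_mul_left n 2)),
        prod_cyclotomic_eq_X_pow_sub_one hn, hset, Finset.prod_image] at hprod
      · rw [hprod, hl', C_neg, C_1]
        ring
      · intro d _ d' _ hdd
        have : 2 * d = 2 * d' := Nat.eq_of_mul_eq_mul_right (Nat.pos_of_ne_zero hn₁) hdd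
        omega
    · have hc := hodd d (Nat.dvd_of_mem_divisors hd)
      rw [hpow, show 2 * d * 2 ^ a = 2 ^ (a + 1) * d by ring,
        Nat.totient_mul (hc.pow_left _), Nat.totient_prime_pow_succ Nat.prime_two]
      simp

variable [Fintype F]

theorem ncard_biUnion_cyclotomicFactors {s : Finset ℕ} {c : ℕ → ℕ} (hc : Set.InjOn c s)
    (hcop : ∀ d ∈ s, (c d).Coprime (Fintype.card F)) :
    (⋃ d ∈ s, cyclotomicFactors F (c d)).ncard = ∑ d ∈ s, (cyclotomicFactors F (c d)).ncard := by
  classical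
  have hfin : ∀ d, (cyclotomicFactors F (c d)).Finite := fun d => cyclotomicFactors_finite _
  have : (⋃ d ∈ s, cyclotomicFactors F (c d)) =
      ((s.biUnion fun d => (hfin d).toFinset : Finset F[X]) : Set F[X]) := by
    ext f
    simp
  rw [this, Set.ncard_coe_finset, Finset.card_biUnion]
  · exact Finset.sum_congr rfl fun d _ => (Set.ncard_eq_toFinset_card _ (hfin d)).symm
  · intro d hd d' hd' hne
    rw [Function.onFun, Set.Finite.disjoint_toFinset]
    exact cyclotomicFactors_disjoint (hcop d hd) (hcop d' hd') fun h => hne (hc hd hd' h)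

theorem N_formulas {n n₁ n₂ : ℕ} (hn : 0 < n) (hq : n.Coprime (Fintype.card F)) {lam : F}
    (hl : lam = 1 ∨ lam = -1) (hnn : n = n₁ * n₂)
    (hrad : UniqueFactorizationMonoid.radical n₁ ∣
      UniqueFactorizationMonoid.radical (orderOf lam))
    (hcop : n₂.Coprime (orderOf lam)) :
    (N₁ n lam : ℚ) = formulaN₁ (Fintype.card F) (orderOf lam) n₁ n₂ ∧
      (N₂ n lam : ℚ) = formulaN₂ (Fintype.card F) (orderOf lam) n₁ n₂ := by
  classical
  have hl0 : lam ≠ 0 := by rcases hl with rfl | rfl <;> simp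
  have hn₁ : n₁ ≠ 0 := by rintro rfl; simp at hnn; omega
  have hr : 0 < orderOf lam := orderOf_pos_iff.mpr
    (isOfFinOrder_iff_pow_eq_one.mpr ⟨2, two_pos, by rcases hl with rfl | rfl <;> simp⟩)
  have hprime : ∀ p : ℕ, p.Prime → p ∣ n₁ → p ∣ orderOf lam := fun p hp hpd =>
    (((UniqueFactorizationMonoid.dvd_radical_iff_of_irreducible hp hn₁).mpr hpd).trans hrad).trans
      UniqueFactorizationMonoid.radical_dvd_self
  obtain ⟨hprod, htot⟩ := prod_cyclotomic_eq hn hl hnn hprime hcop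
  have hrq : (orderOf lam).Coprime (Fintype.card F) := by
    have h1 : orderOf lam ∣ Fintype.card F - 1 :=
      orderOf_dvd_of_pow_eq_one (FiniteField.pow_card_sub_one_eq_one lam hl0)
    have h2 : (Fintype.card F - 1).Coprime (Fintype.card F) := by
      have := (Nat.coprime_self_add_right (m := Fintype.card F - 1) (n := 1)).mpr
        (Nat.coprime_one_right _)
      rwa [Nat.sub_add_cancel Fintype.card_pos] at this
    exact Nat.Coprime.coprime_dvd_left h1 h2
  have hcq : ∀ d ∈ n₂.divisors, (orderOf lam * d * n₁).Coprime (Fintype.card F) := by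
    intro d hd
    rw [mul_assoc]
    refine Nat.Coprime.mul_left hrq (Nat.Coprime.coprime_dvd_left ?_ hq)
    rw [hnn, mul_comm n₁]
    exact mul_dvd_mul_right (Nat.dvd_of_mem_divisors hd) n₁
  have hinj : Set.InjOn (fun d => orderOf lam * d * n₁) (n₂.divisors : Set ℕ) := by
    intro d _ d' _ h
    exact Nat.eq_of_mul_eq_mul_left hr (Nat.eq_of_mul_eq_mul_right (Nat.pos_of_ne_zero hn₁) h)
  have hpos : ∀ d ∈ n₂.divisors, 0 < orderOf lam * d * n₁ := fun d hd =>
    Nat.mul_pos (Nat.mul_pos hr (Nat.pos_of_mem_divisors hd)) (Nat.pos_of_ne_zero hn₁)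
  have hcount : ∀ d ∈ n₂.divisors, ((cyclotomicFactors F (orderOf lam * d * n₁)).ncard : ℚ) =
      n₁ * (d.totient / ordMod (orderOf lam * d * n₁) (Fintype.card F)) := by
    intro d hd
    rw [ncard_cyclotomicFactors (hpos d hd) (hcq d hd), htot d hd]
    push_cast
    ring
  have hunion := irredFactors_eq_biUnion hprod
  constructor
  · rw [N₁, hunion, ncard_biUnion_cyclotomicFactors hinj hcq, formulaN₁, Finset.mul_sum,
      Nat.cast_sum]
    exact Finset.sum_congr rfl hcount
  · rw [N₂, formulaN₂, Finset.mul_sum]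
    set s := n₂.divisors.filter fun d => ∃ w : ℕ, 0 < w ∧
      ((Fintype.card F : ℕ) : ℤ) ^ w ≡ -1 [ZMOD ((orderOf lam * d * n₁ : ℕ) : ℤ)] with hs
    have hsub : s ⊆ n₂.divisors := Finset.filter_subset _ _
    have hset : {f | f ∈ irredFactors n lam ∧ IsSelfReciprocal f} =
        ⋃ d ∈ s, cyclotomicFactors F (orderOf lam * d * n₁) := by
      ext f
      rw [Set.mem_ofPred_eq, hunion]
      simp only [Set.mem_iUnion, exists_prop, hs, Finset.mem_filter]
      constructor
      · rintro ⟨⟨d, hd, hf⟩, hself⟩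
        exact ⟨d, ⟨hd, (isSelfReciprocal_iff_exists_pow (hpos d hd) (hcq d hd) hf).mp hself⟩, hf⟩
      · rintro ⟨d, ⟨hd, hw⟩, hf⟩
        exact ⟨⟨d, hd, hf⟩,
          (isSelfReciprocal_iff_exists_pow (hpos d hd) (hcq d hd) hf).mpr hw⟩
    rw [hset, ncard_biUnion_cyclotomicFactors (hinj.mono (by exact_mod_cast hsub))
      fun d hd => hcq d (hsub hd), Nat.cast_sum]
    exact Finset.sum_congr rfl fun d hd => hcount d (hsub hd)

end Formulas

end LCDCodes

theorem theorem2p9 {F : Type*} [Field F] [Fintype F] (n : ℕ) (hn : 0 < n)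
    (hq : Nat.Coprime n (Fintype.card F)) :
    -- every constacyclic code with constant other than 1 and -1 is Euclidean LCD
    (∀ lam : F, lam ≠ 0 → lam ≠ 1 → lam ≠ -1 →
      ∀ D : Submodule F (Fin n → F), LCDCodes.IsConstacyclic lam D → LCDCodes.IsEuclideanLCD D) ∧
    -- cyclic codes (lam = 1) and negacyclic codes (lam = -1)
    (∀ lam : F, lam = 1 ∨ lam = -1 →
      Even (LCDCodes.N₁ n lam + LCDCodes.N₂ n lam) ∧
      {D : Submodule F (Fin n → F) |
          LCDCodes.IsConstacyclic lam D ∧ LCDCodes.IsEuclideanLCD D}.ncard =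
        2 ^ ((LCDCodes.N₁ n lam + LCDCodes.N₂ n lam) / 2) ∧
      -- the explicit values of the numbers of factors
      ∀ n₁ n₂ : ℕ, n = n₁ * n₂ →
        UniqueFactorizationMonoid.radical n₁ ∣ UniqueFactorizationMonoid.radical (orderOf lam) →
        Nat.Coprime n₂ (orderOf lam) →
        (LCDCodes.N₁ n lam : ℚ) =
            LCDCodes.formulaN₁ (Fintype.card F) (orderOf lam) n₁ n₂ ∧
          (LCDCodes.N₂ n lam : ℚ) =
            LCDCodes.formulaN₂ (Fintype.card F) (orderOf lam) n₁ n₂) := by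
  have hnF : (n : F) ≠ 0 := LCDCodes.natCast_ne_zero_of_coprime_card hq
  refine ⟨fun lam h0 h1 h2 D hD => LCDCodes.isEuclideanLCD_of_ne hn h0 h1 h2 hD, fun lam hl => ?_⟩
  have hsq : lam * lam = 1 := by rcases hl with rfl | rfl <;> simp
  obtain ⟨heven, hcard⟩ := LCDCodes.even_and_ncard_LCD hn hnF hsq
  exact ⟨heven, hcard, fun n₁ n₂ hnn hrad hcop => LCDCodes.N_formulas hn hq hl hnn hrad hcop⟩
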